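/- Let $F$ be a field of characteristic different from $2$ (for example $\mathbb{R}$ or $\mathbb{C}$). Let $T$ be a (finite) tree with $n$ vertices $1,\dots,n$ and edges $e_1,\dots,e_{n-1}$, and let an $s\times s$ matrix $W_i$ over $F$ be assigned to each edge $e_i$ as its weight, $i=1,\dots,n-1$. Let $D$ be the distance matrix of $T$, i.e. the $ns\times ns$ block matrix whose $(i,j)$ block is the sum of the weights of the edges on the unique path from $i$ to $j$ in $T$ (so the diagonal blocks are $0$). Then $D$ is invertible if and only if every $W_i$, $i=1,\dots,n-1$, and the sum $\sum_{i=1}^{n-1}W_i$ are invertible. Suppose $D$ is invertible. Let $L$ be the Laplacian matrix of $T$ in which each edge weight is replaced by its inverse, i.e. the $ns\times ns$ block matrix whose $(i,i)$ block is the sum of the inverses of the weights of the edges incident with $i$, whose $(i,j)$ block for $i\neq j$ is $-W^{-1}$ if $i$ and $j$ are joined by an edge of weight $W$, and is $0$ if they are not adjacent. Set $\delta_i=2-d_i$, where $d_i$ is the degree of the vertex $i$, and $\delta=(\delta_1,\dots,\delta_n)^T$. Then $$D^{-1}=-\frac12 L+\frac12\,\delta\delta^T\otimes\Big(\sum_{i=1}^{n-1}W_i\Big)^{-1},$$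 where $A\otimes B$ denotes the Kronecker product, the block matrix $(a_{ij}B)$. -/

import Mathlib

open scoped Kronecker

namespace MatrixWeightedTree

/-- The unique path from `i` to `j` in the tree `T`. -/
noncomputable def path {V : Type*} {T : SimpleGraph V} (hT : T.IsTree) (i j : V) : T.Walk i j :=
  (hT.existsUnique_path i j).choose

theorem path_isPath {V : Type*} {T : SimpleGraph V} (hT : T.IsTree) (i j : V) :
    (path hT i j).IsPath :=
  (hT.existsUnique_path i j).choose_spec.1

/-- The block distance matrix of a tree with matrix weights: its `(i, j)` block is the sum of the
weights of the edges on the path from `i` to `j`. Only the values of `W` at edges of `T` matter. -/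
noncomputable def distMatrix {V K : Type*} [Field K] {s : ℕ} {T : SimpleGraph V} (hT : T.IsTree)
    (W : Sym2 V → Matrix (Fin s) (Fin s) K) : Matrix (V × Fin s) (V × Fin s) K :=
  Matrix.comp V V (Fin s) (Fin s) K
    (Matrix.of fun i j => ((path hT i j).edges.map W).sum)

/-- The block Laplacian matrix of a graph with matrix weights: the `(i, i)` block is the sum of the
weights of the edges incident with `i`; for `i ≠ j` the `(i, j)` block is minus the weight of the
edge `ij` if there is one, and zero otherwise. Only the values of `W` at edges matter. -/
def laplacian {V K : Type*} [Fintype V] [DecidableEq V] [Field K] {s : ℕ}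
    (T : SimpleGraph V) [DecidableRel T.Adj]
    (W : Sym2 V → Matrix (Fin s) (Fin s) K) : Matrix (V × Fin s) (V × Fin s) K :=
  Matrix.comp V V (Fin s) (Fin s) K
    (Matrix.of fun i j =>
      if i = j then ∑ e ∈ T.incidenceFinset i, W e
      else if T.Adj i j then -W s(i, j) else 0)

/-- The vector `δ` with `δ i = 2 - deg i`. -/
def delta {V : Type*} (K : Type*) [Fintype V] [Field K]
    (T : SimpleGraph V) [DecidableRel T.Adj] (i : V) : K :=
  2 - (T.degree i : K)

end MatrixWeightedTree

/-!
For an edge `e` of the tree, let `f_e : V → {1, -1}` be the sign vector of the two sides of `e`.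
Then `e` lies on the path from `i` to `j` exactly when `f_e i * f_e j = -1`, so the `(i, j)` block
of `2 D` is `∑ e, (1 - f_e i * f_e j) • W e`. In other words, with `F` the matrix whose columns are
the all-ones vector and the vectors `f_e`,
`2 D = (F ⊗ I) * diag (∑ e, W e, -W e₁, …) * (F ⊗ I)ᵀ` (`signMatrix_congr_eq_dist`).

The matrix `F` is square and invertible: if `G` has rows `δ` and the incidence vectors of the edges,
oriented by the signs `f_e`, then
`(F * G) i j = δ j + ∑ e ∋ j, f_e i * f_e j = 2 - 2 * #{e ∋ j on the path from i to j}`,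
which is `2` for `i = j` and `0` otherwise, a path to `j` having just one edge at `j`
(`signMatrix_mul_incidenceMatrix`). Hence `D` is invertible exactly when the diagonal blocks are,
and then `2 D⁻¹ = (G ⊗ I)ᵀ * diag ((∑ e, W e)⁻¹, -(W e₁)⁻¹, …) * (G ⊗ I)`, which is
`δ δᵀ ⊗ (∑ e, W e)⁻¹` minus the Laplacian of the inverse weights
(`incidenceMatrix_congr_eq_laplacian`).

Instead of Kronecker products with an identity matrix, the block matrices are treated as matrices
over the `K`-algebra `R` of `s × s` matrices, and `F`, `G` are mapped along `algebraMap K R`.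
-/

namespace MatrixWeightedTree

open Matrix

/-! ### Signs of the two sides of an edge -/

/-- The sign vector of the cut of `T` at `e`: it is `1` on the component of `T - e` that contains
the end `e.out.1` of `e`, and `-1` elsewhere. The choice of the end only affects a global sign,
which cancels in the products `cutSign i * cutSign j`. -/
noncomputable def cutSign {V : Type*} (K : Type*) [Field K] (T : SimpleGraph V) (e : Sym2 V)
    (i : V) : K :=
  open Classical in if (T.deleteEdges {e}).Reachable e.out.1 i then 1 else -1

section Sign

variable {V K : Type*} [Field K] {T : SimpleGraph V}

theorem cutSign_mul_self (e : Sym2 V) (i : V) : cutSign K T e i * cutSign K T e i = 1 := by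
  unfold cutSign
  split_ifs <;> simp

theorem cutSign_eq_of_adj {e : Sym2 V} {i j : V} (h : T.Adj i j) (he : s(i, j) ≠ e) :
    cutSign K T e i = cutSign K T e j := by
  have hij : (T.deleteEdges {e}).Adj i j := by simp [h, he]
  have : (T.deleteEdges {e}).Reachable e.out.1 i ↔ (T.deleteEdges {e}).Reachable e.out.1 j :=
    ⟨fun hr => hr.trans hij.reachable, fun hr => hr.trans hij.symm.reachable⟩
  unfold cutSign
  split_ifs with h1 h2 h2
  exacts [rfl, absurd (this.1 h1) h2, absurd (this.2 h2) h1, rfl]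

theorem cutSign_mul_cutSign_of_edge (hT : T.IsTree) {i j : V} (h : T.Adj i j) :
    cutSign K T s(i, j) i * cutSign K T s(i, j) j = -1 := by
  have hb : ¬ (T.deleteEdges {s(i, j)}).Reachable i j :=
    SimpleGraph.isBridge_iff.1 (SimpleGraph.isAcyclic_iff_forall_isBridge.1 hT.isAcyclic
      ((SimpleGraph.mem_edgeSet T).2 h))
  have hout : s((s(i, j)).out.1, (s(i, j)).out.2) = s(i, j) := Quot.out_eq _
  unfold cutSign
  rcases Sym2.eq_iff.1 hout with ⟨h1, -⟩ | ⟨h1, -⟩ <;> rw [h1]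
  · simp [hb]
  · have hb' : ¬ (T.deleteEdges {s(i, j)}).Reachable j i := fun hr => hb hr.symm
    simp [hb']

/-- The sign flips each time a walk crosses `e`. -/
theorem cutSign_mul_cutSign_of_walk [DecidableEq V] (hT : T.IsTree) (e : Sym2 V) {i j : V}
    (p : T.Walk i j) :
    cutSign K T e i * cutSign K T e j = (-1) ^ p.edges.count e := by
  induction p with
  | nil => simp [cutSign_mul_self]
  | @cons u v w h p ih =>
    rw [SimpleGraph.Walk.edges_cons, List.count_cons]
    by_cases he : s(u, v) = e
    · subst he
      have h1 := cutSign_mul_cutSign_of_edge (K := K) hT h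
      have h2 := cutSign_mul_self (K := K) (T := T) s(u, v) v
      simp only [beq_self_eq_true, if_true, pow_succ, ← ih]
      linear_combination (cutSign K T s(u, v) v * cutSign K T s(u, v) w) * h1
        - cutSign K T s(u, v) u * cutSign K T s(u, v) w * h2
    · rw [cutSign_eq_of_adj h he, ih]
      simp [he]

theorem cutSign_mul_cutSign [DecidableEq V] (hT : T.IsTree) (e : Sym2 V) (i j : V) :
    cutSign K T e i * cutSign K T e j = 1 - if e ∈ (path hT i j).edges then 2 else 0 := by
  rw [cutSign_mul_cutSign_of_walk hT e (path hT i j)]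
  have hnd : (path hT i j).edges.Nodup := (path_isPath hT i j).isTrail.edges_nodup
  split_ifs with h
  · rw [List.count_eq_one_of_mem hnd h]; norm_num
  · rw [List.count_eq_zero_of_not_mem h]; norm_num

end Sign

/-! ### The sign matrix and its inverse -/

section SignMatrix

variable {V : Type*} (K : Type*) [Field K] (T : SimpleGraph V)

/-- The matrix whose columns are the all-ones vector, indexed by `none`, and the sign vectors of
the cuts at the edges of `T`. -/
noncomputable def signMatrix : Matrix V (Option T.edgeSet) K :=
  of fun i o => o.elim 1 fun e => cutSign K T e i

/-- The matrix whose rows are `delta`, indexed by `none`, and for each edge `e` of `T` the incidence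
vector of `e`, oriented so that its entry at an end of `e` is the sign of that end. -/
noncomputable def incidenceMatrix [Fintype V] [DecidableEq V] [DecidableRel T.Adj] :
    Matrix (Option T.edgeSet) V K :=
  of fun o j => o.elim (delta K T j) fun e => if j ∈ (e : Sym2 V) then cutSign K T e j else 0

variable {T} [Fintype V] [DecidableRel T.Adj]

theorem sum_edgeSet_eq {M : Type*} [AddCommMonoid M] (f : Sym2 V → M) :
    ∑ e : T.edgeSet, f e = ∑ e ∈ T.edgeFinset, f e :=
  (Finset.sum_subtype _ (fun _ => SimpleGraph.mem_edgeFinset) f).symm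

variable [DecidableEq V]

theorem sum_edgeSet_mem {M : Type*} [AddCommMonoid M] (f : Sym2 V → M) (j : V) :
    ∑ e : T.edgeSet, (if j ∈ (e : Sym2 V) then f e else 0) = ∑ e ∈ T.incidenceFinset j, f e := by
  rw [sum_edgeSet_eq (fun e => if j ∈ e then f e else 0), ← Finset.sum_filter,
    SimpleGraph.incidenceFinset_eq_filter]

/-- A path ending at `j` and starting elsewhere uses exactly one edge at `j`. -/
theorem card_incidenceFinset_filter_mem_path (hT : T.IsTree) (i j : V) :
    ((T.incidenceFinset j).filter (· ∈ (path hT i j).edges)).card = if i = j then 0 else 1 := by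
  have hp := (path_isPath hT i j).reverse
  have hmem : ∀ e, e ∈ (path hT i j).edges ↔ e ∈ (path hT i j).reverse.edges := by simp
  simp only [hmem]
  generalize (path hT i j).reverse = p at hp
  cases p with
  | nil => simp
  | @cons _ v _ h p =>
    rw [SimpleGraph.Walk.cons_isPath_iff] at hp
    have hij : i ≠ j := fun hij => hp.2 (hij ▸ p.end_mem_support)
    rw [if_neg hij, Finset.card_eq_one]
    refine ⟨s(j, v), ?_⟩
    ext e
    simp only [Finset.mem_filter, SimpleGraph.mem_incidenceFinset, SimpleGraph.Walk.edges_cons,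
      List.mem_cons, Finset.mem_singleton]
    constructor
    · rintro ⟨he, rfl | hep⟩
      · rfl
      · obtain ⟨w, rfl⟩ := Sym2.mem_iff_exists.1 he.2
        exact absurd (p.fst_mem_support_of_mem_edges hep) hp.2
    · rintro rfl
      exact ⟨⟨h, Sym2.mem_mk_left _ _⟩, Or.inl rfl⟩

theorem signMatrix_mul_incidenceMatrix (hT : T.IsTree) :
    signMatrix K T * incidenceMatrix K T = (2 : K) • (1 : Matrix V V K) := by
  ext i j
  have h : ∀ e : T.edgeSet, cutSign K T e i * (if j ∈ (e : Sym2 V) then cutSign K T e j else 0) =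
      if j ∈ (e : Sym2 V) then
        (1 : K) - (if (e : Sym2 V) ∈ (path hT i j).edges then 2 else 0) else 0 := by
    intro e
    rw [mul_ite, mul_zero, cutSign_mul_cutSign hT]
  simp only [mul_apply, Fintype.sum_option, signMatrix, incidenceMatrix, of_apply, Option.elim, h]
  rw [sum_edgeSet_mem (T := T)
    (fun e => (1 : K) - (if e ∈ (path hT i j).edges then 2 else 0)) j,
    Finset.sum_sub_distrib, ← Finset.sum_filter, Finset.sum_const, Finset.sum_const,
    card_incidenceFinset_filter_mem_path, SimpleGraph.card_incidenceFinset_eq_degree, delta]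
  by_cases hij : i = j <;> simp [hij]

/-- The two matrices are square, because a tree has one vertex more than edges. -/
theorem incidenceMatrix_mul_signMatrix (h2 : (2 : K) ≠ 0) (hT : T.IsTree) :
    incidenceMatrix K T * signMatrix K T = (2 : K) • (1 : Matrix _ _ K) := by
  have hcard : Fintype.card V = Fintype.card (Option T.edgeSet) := by
    rw [Fintype.card_option, ← SimpleGraph.edgeFinset_card, hT.card_edgeFinset]
  have h : signMatrix K T * ((2 : K)⁻¹ • incidenceMatrix K T) = 1 := by
    rw [Matrix.mul_smul, signMatrix_mul_incidenceMatrix K hT, smul_smul, inv_mul_cancel₀ h2, one_smul]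
  have h' := (mul_eq_one_comm_of_card_eq _ _ _ hcard).1 h
  rw [Matrix.smul_mul] at h'
  rw [← h', smul_smul, mul_inv_cancel₀ h2, one_smul]

end SignMatrix

/-! ### Factorization of the distance matrix and of the Laplacian -/

section Factorization

variable {V K R : Type*} [Field K] [Ring R] [Algebra K R] [Fintype V] [DecidableEq V]
  {T : SimpleGraph V} [DecidableRel T.Adj]

/-- Twice the distance matrix is congruent, via the sign matrix, to the diagonal matrix of the total
weight and the negatives of the weights. -/
theorem signMatrix_congr_eq_dist (hT : T.IsTree) (W : Sym2 V → R) :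
    (signMatrix K T).map (algebraMap K R) *
        diagonal (fun o : Option T.edgeSet => o.elim (∑ e ∈ T.edgeFinset, W e) fun e => -W e) *
        (signMatrix K T)ᵀ.map (algebraMap K R) =
      (2 : K) • of fun i j => ((path hT i j).edges.map W).sum := by
  ext i j
  have hnd : (path hT i j).edges.Nodup := (path_isPath hT i j).isTrail.edges_nodup
  have hsub : T.edgeFinset.filter (· ∈ (path hT i j).edges) = (path hT i j).edges.toFinset := by
    ext e
    simp only [Finset.mem_filter, SimpleGraph.mem_edgeFinset, List.mem_toFinset,
      and_iff_right_iff_imp]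
    exact fun he => (path hT i j).edges_subset_edgeSet he
  have h : ∀ e : T.edgeSet, algebraMap K R (cutSign K T e i) * -W e *
      algebraMap K R (cutSign K T e j) =
      (if (e : Sym2 V) ∈ (path hT i j).edges then (2 : K) • W e else 0) - W e := by
    intro e
    rw [mul_assoc, ← Algebra.commutes, ← mul_assoc, ← map_mul, cutSign_mul_cutSign hT,
      ← Algebra.smul_def, sub_smul, one_smul]
    split_ifs <;> simp [sub_eq_add_neg, add_comm]
  rw [mul_apply]
  simp only [mul_diagonal, Fintype.sum_option, signMatrix, map_apply, transpose_apply, of_apply,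
    Option.elim, h, Matrix.smul_apply, map_one, one_mul, mul_one]
  rw [sum_edgeSet_eq (T := T)
    (fun e => (if e ∈ (path hT i j).edges then (2 : K) • W e else 0) - W e),
    Finset.sum_sub_distrib, add_sub_cancel, ← Finset.sum_filter, hsub, ← Finset.smul_sum,
    List.sum_toFinset _ hnd]

/-- The Laplacian and the rank-one correction arise together by congruence via the incidence
matrix. -/
theorem incidenceMatrix_congr_eq_laplacian (hT : T.IsTree) (U : Sym2 V → R) (P : R) :
    (incidenceMatrix K T)ᵀ.map (algebraMap K R) *
        diagonal (fun o : Option T.edgeSet => o.elim P fun e => -U e) *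
        (incidenceMatrix K T).map (algebraMap K R) =
      of fun i j => (delta K T i * delta K T j) • P -
        if i = j then ∑ e ∈ T.incidenceFinset i, U e
        else if T.Adj i j then -U s(i, j) else 0 := by
  ext i j
  have h : ∀ (c d : K) (x : R), algebraMap K R c * x * algebraMap K R d = (c * d) • x := by
    intro c d x
    rw [mul_assoc, ← Algebra.commutes, ← mul_assoc, ← map_mul, ← Algebra.smul_def]
  rw [mul_apply]
  simp only [mul_diagonal, Fintype.sum_option, incidenceMatrix, map_apply, transpose_apply,
    of_apply, Option.elim, h]
  rw [sub_eq_add_neg]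
  congr 1
  by_cases hij : i = j
  · subst hij
    have h' : ∀ e : T.edgeSet, ((if i ∈ (e : Sym2 V) then cutSign K T e i else 0) *
        (if i ∈ (e : Sym2 V) then cutSign K T e i else 0)) • -U e =
        if i ∈ (e : Sym2 V) then -U e else 0 := by
      intro e
      split_ifs <;> simp [cutSign_mul_self]
    simp only [h', if_true]
    rw [sum_edgeSet_mem (T := T) (fun e => -U e) i, Finset.sum_neg_distrib]
  · have h' : ∀ e : T.edgeSet, (e : Sym2 V) ≠ s(i, j) →
        ((if i ∈ (e : Sym2 V) then cutSign K T e i else 0) *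
        (if j ∈ (e : Sym2 V) then cutSign K T e j else 0)) • -U e = 0 := by
      intro e he
      have := (Sym2.mem_and_mem_iff (z := (e : Sym2 V)) hij).not.2 he
      rw [not_and_or] at this
      rcases this with h1 | h1 <;> simp [h1]
    rw [if_neg hij]
    split_ifs with hadj
    · rw [Fintype.sum_eq_single (⟨s(i, j), hadj⟩ : T.edgeSet)
        fun e he => h' e fun hc => he (Subtype.ext hc)]
      simp [cutSign_mul_cutSign_of_edge hT hadj]
    · rw [neg_zero]
      refine Finset.sum_eq_zero fun e _ => h' e fun hc => hadj ?_
      exact (SimpleGraph.mem_edgeSet T).1 (hc ▸ e.2)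

end Factorization

/-! ### Invertibility of congruent block matrices -/

section Congruence

/-- Scalar matrices that are inverse to each other up to the factor `2` remain so over the
algebra `R`. -/
theorem map_mul_map_eq_two_smul {m n K R : Type*} [Fintype n] [DecidableEq m]
    [Field K] [Ring R] [Algebra K R] {A : Matrix m n K} {B : Matrix n m K}
    (h : A * B = (2 : K) • (1 : Matrix m m K)) :
    A.map (algebraMap K R) * B.map (algebraMap K R) = (2 : K) • (1 : Matrix m m R) := by
  rw [← Matrix.map_mul, h]
  ext i j
  rw [Matrix.map_apply, Matrix.smul_apply, Matrix.smul_apply, smul_eq_mul, map_mul, Algebra.smul_def,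
    one_apply, one_apply, apply_ite (algebraMap K R), map_one, map_zero]

theorem transpose_mul_transpose_eq_two_smul {m n K : Type*} [Fintype n] [DecidableEq m]
    [Field K] {A : Matrix m n K} {B : Matrix n m K}
    (h : A * B = (2 : K) • (1 : Matrix m m K)) : Bᵀ * Aᵀ = (2 : K) • (1 : Matrix m m K) := by
  rw [← transpose_mul, h, transpose_smul, transpose_one]

variable {m n K R : Type*} [Fintype m] [Fintype n] [DecidableEq m] [DecidableEq n]
  [Field K] [Ring R] [Algebra K R]

theorem isUnit_diagonal_iff_forall (d : n → R) : IsUnit (diagonal d) ↔ ∀ i, IsUnit (d i) := by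
  constructor
  · rintro ⟨u, hu⟩ i
    have h1 := congrFun (congrFun u.mul_inv i) i
    have h2 := congrFun (congrFun u.inv_mul i) i
    rw [hu, diagonal_mul, one_apply_eq] at h1
    rw [hu, mul_diagonal, one_apply_eq] at h2
    exact ⟨⟨d i, _, h1, h2⟩, rfl⟩
  · intro h
    have : diagonal d = diagonalRingHom n R d := rfl
    rw [this]
    exact (Pi.isUnit_iff.2 h).map (diagonalRingHom n R)

/-- The inverse of `2⁻¹ • A * X * Aᵀ` is `2⁻¹ • Bᵀ * Y * B` if `Y` is the inverse of `X` and
`A`, `B` are inverse to each other up to the factor `2`. -/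
theorem congr_mul_congr_eq_one (h2 : (2 : K) ≠ 0) {A : Matrix m n K} {B : Matrix n m K}
    (hAB : A * B = (2 : K) • (1 : Matrix m m K)) (hBA : B * A = (2 : K) • (1 : Matrix n n K))
    {X Y : Matrix n n R} (hXY : X * Y = 1) {D E : Matrix m m R}
    (hD : A.map (algebraMap K R) * X * Aᵀ.map (algebraMap K R) = (2 : K) • D)
    (hE : Bᵀ.map (algebraMap K R) * Y * B.map (algebraMap K R) = (2 : K) • E) : D * E = 1 := by
  have h1 := map_mul_map_eq_two_smul (R := R) (transpose_mul_transpose_eq_two_smul hBA)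
  have h3 := map_mul_map_eq_two_smul (R := R) hAB
  have h : (2 : K) • D * (2 : K) • E = ((2 : K) * 2) • (1 : Matrix m m R) := by
    rw [← hD, ← hE]
    calc _ = A.map (algebraMap K R) * (X * (Aᵀ.map (algebraMap K R) * Bᵀ.map (algebraMap K R)) * Y)
          * B.map (algebraMap K R) := by simp only [Matrix.mul_assoc]
      _ = _ := by
        rw [h1]
        simp only [Matrix.mul_smul, Matrix.smul_mul, Matrix.mul_one, hXY, h3, smul_smul]
  rw [smul_mul_smul_comm] at h
  exact smul_right_injective _ (mul_ne_zero h2 h2) h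

theorem isUnit_of_congr (h2 : (2 : K) ≠ 0) {A : Matrix m n K} {B : Matrix n m K}
    (hAB : A * B = (2 : K) • (1 : Matrix m m K)) (hBA : B * A = (2 : K) • (1 : Matrix n n K))
    {X : Matrix n n R} {D : Matrix m m R}
    (hD : A.map (algebraMap K R) * X * Aᵀ.map (algebraMap K R) = (2 : K) • D)
    (hX : IsUnit X) : IsUnit D := by
  obtain ⟨⟨X, Y, hXY, hYX⟩, rfl⟩ := hX
  have hE : Bᵀ.map (algebraMap K R) * Y * B.map (algebraMap K R) =
      (2 : K) • (2 : K)⁻¹ • (Bᵀ.map (algebraMap K R) * Y * B.map (algebraMap K R)) := by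
    rw [smul_smul, mul_inv_cancel₀ h2, one_smul]
  exact ⟨⟨D, _, congr_mul_congr_eq_one h2 hAB hBA hXY hD hE,
    congr_mul_congr_eq_one h2 (transpose_mul_transpose_eq_two_smul hAB)
      (transpose_mul_transpose_eq_two_smul hBA) hYX hE hD⟩, rfl⟩

theorem isUnit_iff_of_congr (h2 : (2 : K) ≠ 0) {A : Matrix m n K} {B : Matrix n m K}
    (hAB : A * B = (2 : K) • (1 : Matrix m m K)) (hBA : B * A = (2 : K) • (1 : Matrix n n K))
    {X : Matrix n n R} {D : Matrix m m R}
    (hD : A.map (algebraMap K R) * X * Aᵀ.map (algebraMap K R) = (2 : K) • D) :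
    IsUnit D ↔ IsUnit X := by
  refine ⟨isUnit_of_congr h2 hBA hAB ?_, isUnit_of_congr h2 hAB hBA hD⟩
  refine smul_right_injective _ h2 ?_
  calc (2 : K) • (B.map (algebraMap K R) * D * Bᵀ.map (algebraMap K R))
      = B.map (algebraMap K R) * ((2 : K) • D) * Bᵀ.map (algebraMap K R) := by
        rw [Matrix.mul_smul, Matrix.smul_mul]
    _ = (B.map (algebraMap K R) * A.map (algebraMap K R)) * X *
          (Aᵀ.map (algebraMap K R) * Bᵀ.map (algebraMap K R)) := by
        rw [← hD]; simp only [Matrix.mul_assoc]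
    _ = (2 : K) • (2 : K) • X := by
        rw [map_mul_map_eq_two_smul (R := R) hBA,
          map_mul_map_eq_two_smul (R := R) (transpose_mul_transpose_eq_two_smul hBA)]
        simp only [Matrix.smul_mul, Matrix.mul_smul, Matrix.one_mul, Matrix.mul_one]

end Congruence

end MatrixWeightedTree

theorem theorem3p2 {K : Type*} [Field K] (h2 : (2 : K) ≠ 0)
    {V : Type*} [Fintype V] [DecidableEq V]
    (T : SimpleGraph V) [DecidableRel T.Adj] (hT : T.IsTree)
    (s : ℕ) (W : Sym2 V → Matrix (Fin s) (Fin s) K) :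
    (IsUnit (MatrixWeightedTree.distMatrix hT W) ↔
      (∀ e ∈ T.edgeFinset, IsUnit (W e)) ∧ IsUnit (∑ e ∈ T.edgeFinset, W e)) ∧
    (IsUnit (MatrixWeightedTree.distMatrix hT W) →
      (MatrixWeightedTree.distMatrix hT W)⁻¹ =
        -((1 / 2 : K) • MatrixWeightedTree.laplacian T (fun e => (W e)⁻¹)) +
          (1 / 2 : K) •
            (Matrix.vecMulVec (MatrixWeightedTree.delta K T) (MatrixWeightedTree.delta K T) ⊗ₖ
              (∑ e ∈ T.edgeFinset, W e)⁻¹)) := by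
  have hFG := MatrixWeightedTree.signMatrix_mul_incidenceMatrix K hT
  have hGF := MatrixWeightedTree.incidenceMatrix_mul_signMatrix K h2 hT
  have hD := MatrixWeightedTree.signMatrix_congr_eq_dist (K := K) hT W
  have hiff : IsUnit (MatrixWeightedTree.distMatrix hT W) ↔
      (∀ e ∈ T.edgeFinset, IsUnit (W e)) ∧ IsUnit (∑ e ∈ T.edgeFinset, W e) := by
    have h := (MulEquiv.isUnit_map (Matrix.compRingEquiv V (Fin s) K)).trans
      (MatrixWeightedTree.isUnit_iff_of_congr h2 hFG hGF hD)
    refine h.trans ((MatrixWeightedTree.isUnit_diagonal_iff_forall _).trans ?_)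
    rw [Option.forall, and_comm]
    simp [SimpleGraph.mem_edgeFinset]
  refine ⟨hiff, fun hu => Matrix.inv_eq_right_inv ?_⟩
  obtain ⟨hW, hS⟩ := hiff.1 hu
  have hE := MatrixWeightedTree.incidenceMatrix_congr_eq_laplacian (K := K) hT
    (fun e => (W e)⁻¹) (∑ e ∈ T.edgeFinset, W e)⁻¹
  -- Insert the factor `2 * 2⁻¹` to match the shape `2 • E` of the congruence.
  rw [← one_smul K (Matrix.of _), ← mul_inv_cancel₀ h2, mul_smul] at hE
  have hdiag : Matrix.diagonal (fun o : Option T.edgeSet =>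
        o.elim (∑ e ∈ T.edgeFinset, W e) fun e => -W e) *
      Matrix.diagonal (fun o : Option T.edgeSet =>
        o.elim (∑ e ∈ T.edgeFinset, W e)⁻¹ fun e => -(W e)⁻¹) = 1 := by
    rw [Matrix.diagonal_mul_diagonal, ← Matrix.diagonal_one]
    congr 1
    funext o
    cases o with
    | none => exact Matrix.mul_nonsing_inv _ ((Matrix.isUnit_iff_isUnit_det _).1 hS)
    | some e =>
      simpa using Matrix.mul_nonsing_inv _ ((Matrix.isUnit_iff_isUnit_det _).1
        (hW e (SimpleGraph.mem_edgeFinset.2 e.2)))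
  have h := congrArg (Matrix.compRingEquiv V (Fin s) K)
    (MatrixWeightedTree.congr_mul_congr_eq_one h2 hFG hGF hdiag hD hE)
  rw [map_mul, map_one] at h
  rw [← h]
  congr 1
  ext ⟨i, a⟩ ⟨j, b⟩
  simp only [MatrixWeightedTree.laplacian, Matrix.compRingEquiv_apply, Matrix.comp_apply,
    Matrix.add_apply, Matrix.neg_apply, Matrix.smul_apply, Matrix.sub_apply, Matrix.of_apply,
    Matrix.kroneckerMap_apply, Matrix.vecMulVec_apply, smul_eq_mul]
  ring
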